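/- Let $K$ be an algebraically closed field with characteristic exponent $p$ (so $p=1$ if $\operatorname{char} K=0$, and $p=\operatorname{char} K$ otherwise). Let $d$ be a nonnegative integer such that $d\notin\{0\cdot p^k,\ 1\cdot p^k,\ 2\cdot p^k\}$ for every integer $k\ge 0$, and let $r\ge 0$ be an integer. For a vector space $V$ over $K$ let $S^dV$ be its $d$-th symmetric power, the quotient of $V^{\otimes d}$ by the span of all $T-\sigma(T)$ with $T\in V^{\otimes d}$, $\sigma\in S_d$; write $v_1\cdots v_d$ for the image of $v_1\otimes\cdots\otimes v_d$. For a subspace $U \subseteq V$, regard $S^dU$ as a subspace of $S^dV$. An element $f\in S^dV$ is regarded as a homogeneous polynomial on $V^*$, where $v_1\cdots v_d$ takes the value $\xi(v_1)\cdots\xi(v_d)$ at $\xi\in V^*$. For $V$ finite-dimensional, the slice rank of $f$ is the minimal codimension of a (possibly empty) linear subspace of $\mathbb{P}V^*$ on which $f$ vanishes identically, that is, the minimal codimension of a linear subspace of $V^*$ on which $f$ vanishes identically. Let $e_1,\dots,e_r$ be the standard basis of $K^r$ and let $I_r := e_1^d+\dots+e_r^d\in S^dK^r$ be the $r$-th unit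 tensor. Then: 1. $I_r\notin S^dU$ for every proper linear subspace $U\subsetneq K^r$; 2. the slice rank of $I_r$ equals $\lceil r/2\rceil$; 3. the orbit $\operatorname{GL}_r\cdot I_r\subseteq S^dK^r$, under the action $g\cdot(v_1\cdots v_d)=(gv_1)\cdots(gv_d)$, has dimension $r^2$. Here the dimension of the orbit, a locally closed subset of $S^dK^r$, is that of its Zariski closure, i.e. the Krull dimension of the ring of polynomial functions on it. -/

import Mathlib

universe u v w

namespace SymSubrank

/-- The `d`-th symmetric power `S^d V`: the quotient of `V^{⊗ d}` by permutations of the factors.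
(`ULift` only adjusts the universe of the index type `Fin d`, since Mathlib's `SymmetricPower`
wants it in the universe of `K`.) -/
abbrev SymPow (K : Type u) [Field K] (d : ℕ) (V : Type v) [AddCommGroup V] [Module K V] :
    Type (max u v) :=
  SymmetricPower K (ULift.{u} (Fin d)) V

section Lift

variable {K : Type u} [Field K] {d : ℕ} {V : Type v} [AddCommGroup V] [Module K V]
  {W : Type w} [AddCommGroup W] [Module K W]

/-- The simple symmetric tensor `v_1 v_2 ⋯ v_d`. -/
noncomputable def simple (K : Type u) [Field K] {V : Type v} [AddCommGroup V] [Module K V] {d : ℕ}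
    (v : Fin d → V) : SymPow K d V :=
  SymmetricPower.tprod K fun i => v i.down

/-- The linear map on `S^d V` induced by a symmetric multilinear map. -/
noncomputable def lift (m : MultilinearMap K (fun _ : ULift.{u} (Fin d) => V) W)
    (hm : ∀ (e : Equiv.Perm (ULift.{u} (Fin d))) (v : ULift.{u} (Fin d) → V),
      m (fun i => v (e i)) = m v) :
    SymPow K d V →ₗ[K] W :=
  let f : SymPow K d V →+ W :=
    AddCon.lift (addConGen (SymmetricPower.Rel K (ULift.{u} (Fin d)) V))
      (PiTensorProduct.lift m).toAddMonoidHom (AddCon.addConGen_le.2 (by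
        rintro _ _ ⟨e, v⟩
        simp [AddCon.ker_rel, hm e v]))
  { f with
    map_smul' := fun c x => AddCon.induction_on x fun y =>
      (PiTensorProduct.lift m).map_smul c y }

theorem lift_simple (m : MultilinearMap K (fun _ : ULift.{u} (Fin d) => V) W)
    (hm : ∀ (e : Equiv.Perm (ULift.{u} (Fin d))) (v : ULift.{u} (Fin d) → V),
      m (fun i => v (e i)) = m v) (v : Fin d → V) :
    lift m hm (simple K v) = m fun i => v i.down :=
  PiTensorProduct.lift.tprod _

/-- The linear map `S^d V → S^d W`, `v_1 ⋯ v_d ↦ φ(v_1) ⋯ φ(v_d)`, induced by a linear map `φ`. -/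
noncomputable def map (d : ℕ) (φ : V →ₗ[K] W) : SymPow K d V →ₗ[K] SymPow K d W :=
  lift ((SymmetricPower.tprod K).compLinearMap fun _ => φ) fun e v =>
    SymmetricPower.tprod_equiv e fun i => φ (v i)

theorem map_simple (φ : V →ₗ[K] W) (v : Fin d → V) :
    map d φ (simple K v) = simple K fun i => φ (v i) :=
  lift_simple _ _ v

/-- The value of a symmetric tensor at the point `ξ` of `V*`; a symmetric tensor is viewed as
a homogeneous polynomial on `V*`, with `v_1 ⋯ v_d` taking the value `ξ(v_1) ⋯ ξ(v_d)`. -/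
noncomputable def eval (ξ : Module.Dual K V) : SymPow K d V →ₗ[K] K :=
  lift ((MultilinearMap.mkPiAlgebra K (ULift.{u} (Fin d)) K).compLinearMap fun _ => ξ)
    fun e v => by simpa using Equiv.prod_comp e fun i => ξ (v i)

theorem eval_simple (ξ : Module.Dual K V) (v : Fin d → V) :
    eval ξ (simple K v) = ∏ i, ξ (v i) :=
  (lift_simple _ _ v).trans (by
    simpa using Equiv.prod_comp (Equiv.ulift.{u} (α := Fin d)) fun i => ξ (v i))

/-- The subset `S^d U ⊆ S^d V` for a subspace `U ⊆ V`, as the image of `S^d U → S^d V`. -/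
noncomputable def symPowOf (d : ℕ) (U : Submodule K V) : Submodule K (SymPow K d V) :=
  LinearMap.range (map d U.subtype)

/-- The slice rank of `f ∈ S^d V`: the minimal codimension of a linear subspace of `ℙ V*` on which
`f` vanishes identically. Linear subspaces of `ℙ V*` are given by linear subspaces `L` of `V*` (the
empty one by `L = 0`), with the same codimension. The infimum is `⊤` if there is no such `L`. -/
noncomputable def sliceRank [FiniteDimensional K V] (f : SymPow K d V) : ℕ∞ :=
  ⨅ (L : Submodule K (Module.Dual K V)) (_ : ∀ ξ ∈ L, eval ξ f = 0),
    (Module.finrank K (Module.Dual K V ⧸ L) : ℕ∞)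

/-- The orbit of `f ∈ S^d V` under the action of `GL(V)`. -/
def glOrbit (f : SymPow K d V) : Set (SymPow K d V) :=
  {h | ∃ g : V ≃ₗ[K] V, h = map d g.toLinearMap f}

/-- The `K`-algebra of polynomial functions on a subset `S` of a vector space `W`: the functions
`S → K` that are polynomials in restrictions of linear forms on `W`. For `W` finite-dimensional this
is `K[W] / I(S)`, the coordinate ring of the Zariski closure of `S`. -/
def polyFunctions (S : Set W) : Subalgebra K (S → K) :=
  Algebra.adjoin K (Set.range fun (ℓ : Module.Dual K W) (x : S) => ℓ x.1)

/-- The dimension of a subset `S` of a finite-dimensional vector space `W` over an algebraically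
closed field, as used for locally closed (more generally constructible) sets: the dimension of the
Zariski closure of `S`, i.e. the Krull dimension of its coordinate ring. -/
noncomputable def varietyDim (K : Type u) [Field K] {W : Type w} [AddCommGroup W] [Module K W]
    (S : Set W) : WithBot ℕ∞ :=
  ringKrullDim (polyFunctions (K := K) S)

end Lift

/-- The `r`-th unit tensor `I_r = e_1^d + ⋯ + e_r^d ∈ S^d K^r`. -/
noncomputable def unitTensor (K : Type u) [Field K] (d r : ℕ) : SymPow K d (Fin r → K) :=
  ∑ i : Fin r, simple K fun _ : Fin d => (Pi.single i 1 : Fin r → K)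

end SymSubrank

/-!
Write `d = q * m` with `q` a power of `p`, and with `m ≥ 3` and `m ≠ 0` in `K`. The coefficient of
`t ^ q` in `(x + t * y) ^ d` is `m * (x ^ (m - 1) * y) ^ q`, so the power sum `∑ i, x i ^ d` is
invariant under no nonzero translation. If `I_r` were in `S^d U` with `U` proper, a nonzero linear
form vanishing on `U` would be such a translation. If `I_r` vanishes on `L ⊆ (K^r)*`, choose
`dim L` coordinates that identify `L` with a coordinate space; if these were more than half of the
coordinates, some nonzero vector of `L` would vanish in all the others and would again be such a
translation. Conversely, if `ζ ^ d = -1`, pairing the coordinates by `x (2 * i + 1) = ζ * x (2 * i)`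
makes the power sum cancel.

For the orbit, the coefficient of `t ^ q` in `f (x i + t * x j)`, where `x i` and `x j` are
coordinate functions on `K^r`, is linear in `f`, and at `f = M · I_r` it is
`m * (∑ k, M i k ^ (m - 1) * M j k) ^ q`. Since `m ≥ 3`, the Jacobian matrix of the `r ^ 2`
polynomials `∑ k, M i k ^ (m - 1) * M j k` at `M = 1` is a permutation matrix up to factors `m` and
hence invertible. So these polynomials are algebraically independent, whatever the characteristic.
-/

namespace SymSubrank

section AlgebraicIndependence

open MvPolynomial

variable {R A ι σ : Type*} [CommRing R] [CommRing A] [Algebra R A]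

theorem aeval_mul_left_of_isHomogeneous {P : MvPolynomial ι R} {n : ℕ} (hP : P.IsHomogeneous n)
    (t : A) (w : ι → A) : aeval (fun i => t * w i) P = t ^ n * aeval w P := by
  rw [aeval_def, aeval_def, eval₂_eq, eval₂_eq, Finset.mul_sum]
  refine Finset.sum_congr rfl fun d hd => ?_
  have hdeg : ∑ i ∈ d.support, d i = n := by
    simpa [Finsupp.weight_apply, Finsupp.sum] using hP (mem_support_iff.1 hd)
  simp_rw [mul_pow, Finset.prod_mul_distrib, Finset.prod_pow_eq_pow_sum, hdeg]
  ring

theorem coeff_zero_aeval (g : ι → Polynomial A) (P : MvPolynomial ι R) :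
    (aeval g P).coeff 0 = aeval (fun i => (g i).coeff 0) P := by
  simp only [Polynomial.coeff_zero_eq_aeval_zero]
  exact comp_aeval_apply g ((Polynomial.aeval (0 : A)).restrictScalars R) P

theorem coeff_aeval_X_mul (g : ι → Polynomial A) {P : MvPolynomial ι R} {n : ℕ}
    (hP : ∀ k < n, homogeneousComponent k P = 0) :
    (aeval (fun i => Polynomial.X * g i) P).coeff n =
      aeval (fun i => (g i).coeff 0) (homogeneousComponent n P) := by
  conv_lhs => rw [← sum_homogeneousComponent P]
  simp only [map_sum, Polynomial.finsetSum_coeff,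
    aeval_mul_left_of_isHomogeneous (homogeneousComponent_isHomogeneous _ P),
    Polynomial.coeff_X_pow_mul']
  rw [Finset.sum_eq_single n]
  · simp [coeff_zero_aeval]
  · intro k _ hkn
    split_ifs with hk
    · simp [hP k (by omega)]
    · rfl
  · intro hn
    rw [homogeneousComponent_eq_zero n P (by simpa using hn)]
    simp

theorem algebraicIndependent_X_mul {g : ι → Polynomial A}
    (hg : AlgebraicIndependent R fun i => (g i).coeff 0) :
    AlgebraicIndependent R fun i => Polynomial.X * g i := by
  rw [algebraicIndependent_iff] at hg ⊢
  intro P hP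
  have hcomp (n : ℕ) : homogeneousComponent n P = 0 := by
    induction n using Nat.strong_induction_on with
    | _ n ih => exact hg _ (by rw [← coeff_aeval_X_mul g ih, hP, Polynomial.coeff_zero])
  rw [← sum_homogeneousComponent P]
  exact Finset.sum_eq_zero fun n _ => hcomp n

theorem coeff_zero_aeval_line (c : σ → R) (w : σ → A) (F : MvPolynomial σ R) :
    (aeval (fun s => Polynomial.C (algebraMap R A (c s)) + Polynomial.X * Polynomial.C (w s))
      F).coeff 0 = algebraMap R A (MvPolynomial.eval c F) := by
  simp only [coeff_zero_aeval, Polynomial.coeff_add, Polynomial.coeff_C_zero,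
    Polynomial.mul_coeff_zero, Polynomial.coeff_X_zero, zero_mul, add_zero]
  exact aeval_algebraMap_apply A c F

theorem coeff_one_aeval_line [Fintype σ] (c : σ → R) (w : σ → A) (F : MvPolynomial σ R) :
    (aeval (fun s => Polynomial.C (algebraMap R A (c s)) + Polynomial.X * Polynomial.C (w s))
      F).coeff 1 = ∑ s, MvPolynomial.eval c (pderiv s F) • w s := by
  classical
  induction F using MvPolynomial.induction_on with
  | C a => simp [Polynomial.algebraMap_apply]
  | add F G hF hG =>
    simp only [map_add, Polynomial.coeff_add, hF, hG, add_smul, Finset.sum_add_distrib]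
  | mul_X F t hF =>
    have hX : ∑ s, (MvPolynomial.eval c F * MvPolynomial.eval c (pderiv s (X t))) • w s =
        MvPolynomial.eval c F • w t := by
      rw [Finset.sum_eq_single t] <;> simp +contextual [ne_comm]
    have hF' : ∑ s, (MvPolynomial.eval c (X t) * MvPolynomial.eval c (pderiv s F)) • w s =
        c t • ∑ s, MvPolynomial.eval c (pderiv s F) • w s := by
      simp only [eval_X, mul_smul, Finset.smul_sum]
    simp only [map_mul, aeval_X, Polynomial.mul_coeff_one, coeff_zero_aeval_line, hF,
      Derivation.leibniz, map_add, smul_eq_mul, add_smul, Finset.sum_add_distrib, hX, hF']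
    simp [Algebra.smul_def, mul_comm (algebraMap R A (c t)), add_comm]

theorem algebraicIndependent_of_jacobian_mul_eq_one [Fintype σ] [Finite ι]
    [DecidableEq ι] {F : ι → MvPolynomial σ R} (c : σ → R) (B : Matrix σ ι R)
    (hB : (Matrix.of fun i s => MvPolynomial.eval c (pderiv s (F i))) * B = 1) :
    AlgebraicIndependent R F := by
  nontriviality R
  cases nonempty_fintype ι
  let w : σ → MvPolynomial ι R := fun s => ∑ j, B s j • X j
  -- On the line `c + t * B X` the linear term of `F i` is `X i`.
  let line : MvPolynomial σ R →ₐ[R] Polynomial (MvPolynomial ι R) :=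
    aeval fun s => Polynomial.C (algebraMap R _ (c s)) + Polynomial.X * Polynomial.C (w s)
  have hcoeff (i : ι) : (line (F i)).coeff 1 = X i := by
    have hBi (j : ι) :
        ∑ s, MvPolynomial.eval c (pderiv s (F i)) * B s j = if i = j then 1 else 0 := by
      simpa [Matrix.mul_apply, Matrix.one_apply] using congrFun₂ hB i j
    simp only [line, w, coeff_one_aeval_line, Finset.smul_sum, smul_smul]
    rw [Finset.sum_comm]
    simp [← Finset.sum_smul, hBi]
  have hline (i : ι) : line (F i) =
      Polynomial.aeval (Polynomial.X * (line (F i)).divX)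
        (Polynomial.X + Polynomial.C (MvPolynomial.eval c (F i))) := by
    conv_lhs => rw [← Polynomial.X_mul_divX_add (line (F i)), coeff_zero_aeval_line]
    simp [Polynomial.algebraMap_apply]
  have hX : AlgebraicIndependent R fun i => Polynomial.X * (line (F i)).divX := by
    refine algebraicIndependent_X_mul ?_
    simpa [Polynomial.coeff_divX, hcoeff] using algebraicIndependent_X ι R
  have hind : AlgebraicIndependent R fun i => line (F i) := by
    simp_rw +singlePass [hline]
    exact hX.polynomial_aeval_of_transcendental fun i =>
      Polynomial.transcendental _ (by simp) (by simp)
  exact hind.of_comp line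

end AlgebraicIndependence

section Dimension

theorem ringKrullDim_eq_of_isIntegral {R S : Type*} [CommRing R] [CommRing S] [Algebra R S]
    [Algebra.IsIntegral R S] (hinj : Function.Injective (algebraMap R S)) :
    ringKrullDim R = ringKrullDim S := by
  refine le_antisymm (iSup_le fun l => ?_) ?_
  · obtain ⟨P, -, hP, hPl⟩ := Ideal.exists_ideal_over_prime_of_isIntegral l.head.asIdeal
      (⊥ : Ideal S) (by rw [Ideal.comap_bot_of_injective _ hinj]; exact bot_le)
    have : P.LiesOver l.head.asIdeal := ⟨hPl.symm⟩
    obtain ⟨l', hl', -⟩ := Ideal.exists_ltSeries_of_hasGoingUp l P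
    exact hl' ▸ Order.LTSeries.length_le_krullDim l'
  · exact Order.krullDim_le_of_strictMono (PrimeSpectrum.comap (algebraMap R S))
      fun I J hIJ => Ideal.IsIntegral.comap_lt_comap hIJ

theorem ringKrullDim_eq_toNat_trdeg (K : Type u) (A : Type v) [Field K] [CommRing A] [IsDomain A]
    [Algebra K A] [Algebra.FiniteType K A] :
    ringKrullDim A = Cardinal.toNat (Algebra.trdeg K A) := by
  obtain ⟨s, g, hg, hint⟩ := exists_integral_inj_algHom_of_fg K A
  let _ : Algebra (MvPolynomial (Fin s) K) A := g.toRingHom.toAlgebra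
  have : Algebra.IsIntegral (MvPolynomial (Fin s) K) A := ⟨hint⟩
  have : IsScalarTower K (MvPolynomial (Fin s) K) A :=
    IsScalarTower.of_algebraMap_eq fun x => (g.commutes x).symm
  have : FaithfulSMul (MvPolynomial (Fin s) K) A :=
    (faithfulSMul_iff_algebraMap_injective _ _).2 hg
  have htr := lift_trdeg_add_eq K (MvPolynomial (Fin s) K) A
  rw [trdeg_eq_zero (R := MvPolynomial (Fin s) K), MvPolynomial.trdeg_of_isDomain] at htr
  have hs : Cardinal.toNat (Algebra.trdeg K A) = s := by
    simpa using (congrArg Cardinal.toNat htr).symm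
  rw [← ringKrullDim_eq_of_isIntegral (R := MvPolynomial (Fin s) K) hg, hs]
  simp [ringKrullDim_eq_zero_of_field]

end Dimension

section Rigidity

open Polynomial

variable {R : Type*} [CommRing R]

theorem coeff_one_C_add_X_mul_C_pow (m : ℕ) (x y : R) :
    ((C x + X * C y) ^ m).coeff 1 = m * (x ^ (m - 1) * y) := by
  have h := coeff_derivative ((C x + X * C y) ^ m) 0
  simp only [derivative_pow, zero_add, Nat.cast_zero, mul_one] at h
  rw [← h]
  simp [coeff_zero_eq_eval_zero, mul_assoc]

variable (p : ℕ) [ExpChar R p]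

theorem coeff_C_add_X_mul_C_pow (a m : ℕ) (x y : R) :
    ((C x + X * C y) ^ (p ^ a * m)).coeff (p ^ a) = m * (x ^ (m - 1) * y) ^ p ^ a := by
  have h : (C x + X * C y) ^ (p ^ a * m) =
      expand R (p ^ a) ((C (x ^ p ^ a) + X * C (y ^ p ^ a)) ^ m) := by
    simp only [pow_mul, add_pow_expChar_pow, mul_pow, map_pow, map_add, map_mul, expand_C,
      expand_X]
  have h' := coeff_expand_mul (expChar_pow_pos R p a) ((C (x ^ p ^ a) + X * C (y ^ p ^ a)) ^ m) 1
  rw [one_mul] at h'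
  rw [h, h', coeff_one_C_add_X_mul_C_pow, mul_pow, ← pow_mul, ← pow_mul, mul_comm (p ^ a)]

variable [IsDomain R] {a m : ℕ}

theorem eq_zero_of_X_add_C_pow_eq (hm : 2 ≤ m) (hmR : (m : R) ≠ 0) {b c : R}
    (h : (X + C c) ^ (p ^ a * m) = X ^ (p ^ a * m) + C b) : c = 0 := by
  have hq : p ^ a ≠ 0 := (expChar_pow_pos R p a).ne'
  have hcoeff := coeff_C_add_X_mul_C_pow p a m c 1
  have hne : p ^ a ≠ p ^ a * m := (lt_mul_of_one_lt_right (expChar_pow_pos R p a) hm).ne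
  rw [C_1, mul_one, add_comm, h, coeff_add, coeff_X_pow, if_neg hne, coeff_C_of_ne_zero hq,
    add_zero, mul_one, eq_comm, mul_eq_zero_iff_left hmR] at hcoeff
  exact eq_zero_of_pow_eq_zero (eq_zero_of_pow_eq_zero hcoeff)

theorem eq_zero_of_forall_sum_add_pow_eq [Infinite R] {ι : Type*} [Fintype ι] (hm : 2 ≤ m)
    (hmR : (m : R) ≠ 0) {v : ι → R}
    (h : ∀ η : ι → R, ∑ i, (η i + v i) ^ (p ^ a * m) = ∑ i, η i ^ (p ^ a * m)) : v = 0 := by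
  classical
  have hd : p ^ a * m ≠ 0 := mul_ne_zero (expChar_pow_pos R p a).ne' (by omega)
  funext i
  refine eq_zero_of_X_add_C_pow_eq p hm hmR (a := a)
    (b := -∑ j ∈ {i}ᶜ, v j ^ (p ^ a * m)) (Polynomial.funext fun s => ?_)
  have hs := h (Pi.single i s)
  have hv : ∑ j ∈ {i}ᶜ, ((Pi.single i s : ι → R) j + v j) ^ (p ^ a * m) =
      ∑ j ∈ {i}ᶜ, v j ^ (p ^ a * m) :=
    Finset.sum_congr rfl fun j hj => by simp_all [Pi.single_apply]
  have h0 : ∑ j ∈ {i}ᶜ, (Pi.single i s : ι → R) j ^ (p ^ a * m) = 0 :=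
    Finset.sum_eq_zero fun j hj => by simp_all [Pi.single_apply]
  rw [Fintype.sum_eq_add_sum_compl i, Fintype.sum_eq_add_sum_compl i, hv, h0,
    Pi.single_eq_same] at hs
  simp only [eval_pow, eval_add, eval_X, eval_C]
  linear_combination hs

end Rigidity

section Concise

variable {K : Type u} [Field K] {d : ℕ}

theorem eval_map {V : Type v} [AddCommGroup V] [Module K V] {W : Type w} [AddCommGroup W]
    [Module K W] (φ : V →ₗ[K] W) (ξ : Module.Dual K W) (f : SymPow K d V) :
    eval ξ (map d φ f) = eval (ξ ∘ₗ φ) f := by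
  suffices h : eval ξ ∘ₗ map d φ = eval (ξ ∘ₗ φ) from LinearMap.congr_fun h f
  refine LinearMap.ext_on_range (SymmetricPower.span_tprod_eq_top K _ V) fun w => ?_
  have hw : SymmetricPower.tprod K w = simple K fun i : Fin d => w ⟨i⟩ := rfl
  simp only [hw, LinearMap.comp_apply, map_simple, eval_simple]

theorem eval_add_of_mem_symPowOf {V : Type v} [AddCommGroup V] [Module K V] {U : Submodule K V}
    {f : SymPow K d V} (hf : f ∈ symPowOf d U) (ζ : Module.Dual K V) {ξ : Module.Dual K V}
    (hξ : U ≤ LinearMap.ker ξ) : eval (ζ + ξ) f = eval ζ f := by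
  obtain ⟨g, rfl⟩ := hf
  have hU : (ζ + ξ) ∘ₗ U.subtype = ζ ∘ₗ U.subtype :=
    LinearMap.ext fun u => by simpa using hξ u.2
  rw [eval_map, eval_map, hU]

theorem eval_unitTensor {r : ℕ} (ξ : Module.Dual K (Fin r → K)) :
    eval ξ (unitTensor K d r) = ∑ i, ξ (Pi.single i 1) ^ d := by
  simp [unitTensor, eval_simple]

theorem unitTensor_notMem_symPowOf [Infinite K] (p : ℕ) [ExpChar K p] {a m : ℕ} (hm : 2 ≤ m)
    (hmK : (m : K) ≠ 0) {r : ℕ} {U : Submodule K (Fin r → K)} (hU : U ≠ ⊤) :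
    unitTensor K (p ^ a * m) r ∉ symPowOf (p ^ a * m) U := by
  intro hmem
  obtain ⟨w, -, hw⟩ := SetLike.exists_of_lt hU.lt_top
  obtain ⟨ξ, hξw, hξU⟩ := Submodule.exists_le_ker_of_notMem hw
  have hξ : (fun i => ξ (Pi.single i 1)) = (0 : Fin r → K) :=
    eq_zero_of_forall_sum_add_pow_eq p (a := a) hm hmK fun η => by
      simpa [eval_unitTensor, Fintype.linearCombination_apply_single] using
        eval_add_of_mem_symPowOf hmem (Fintype.linearCombination K η) hξU
  have hξ0 : ξ = 0 := LinearMap.pi_ext' fun i => LinearMap.ext_ring (by simpa using congrFun hξ i)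
  exact hξw (by rw [hξ0, LinearMap.zero_apply])

end Concise

section SliceRank

variable {K : Type*} [Field K]

theorem exists_bijective_funLeft_comp {ι L : Type*} [Finite ι] [AddCommGroup L] [Module K L]
    {X : L →ₗ[K] (ι → K)} (hX : Function.Injective X) :
    ∃ s : Set ι, Function.Bijective (LinearMap.funLeft K K ((↑) : s → ι) ∘ₗ X) := by
  classical
  cases nonempty_fintype ι
  have : FiniteDimensional K L := Module.Finite.of_injective X hX
  let x : ι → Module.Dual K L := fun i => LinearMap.proj i ∘ₗ X
  obtain ⟨s, -, -, hspan, hli⟩ := exists_linearIndepOn_extension (linearIndepOn_empty K x)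
    (Set.empty_subset Set.univ)
  have hinj : Function.Injective (LinearMap.funLeft K K ((↑) : s → ι) ∘ₗ X) := by
    refine (injective_iff_map_eq_zero _).2 fun ξ hξ => (injective_iff_map_eq_zero X).1 hX ξ ?_
    have hle : Submodule.span K (x '' s) ≤ LinearMap.ker (Module.Dual.eval K L ξ) := by
      refine Submodule.span_le.2 ?_
      rintro _ ⟨j, hj, rfl⟩
      exact congrFun hξ ⟨j, hj⟩
    exact funext fun i => hle (hspan ⟨i, Set.mem_univ i, rfl⟩)
  have hrank : Module.finrank K L = Module.finrank K (s → K) := by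
    refine le_antisymm (LinearMap.finrank_le_finrank_of_injective hinj) ?_
    rw [Module.finrank_fintype_fun_eq_card, ← Subspace.dual_finrank_eq (K := K) (V := L)]
    exact LinearIndependent.fintype_card_le_finrank hli
  exact ⟨s, hinj, (LinearMap.injective_iff_surjective_of_finrank_eq_finrank hrank).1 hinj⟩

theorem two_mul_finrank_le_of_forall_sum_pow_eq_zero [Infinite K] (p : ℕ) [ExpChar K p] {a m : ℕ}
    (hm : 2 ≤ m) (hmK : (m : K) ≠ 0) {ι L : Type*} [Fintype ι] [AddCommGroup L] [Module K L]
    {X : L →ₗ[K] (ι → K)} (hX : Function.Injective X)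
    (h : ∀ ξ : L, ∑ i, X ξ i ^ (p ^ a * m) = 0) : 2 * Module.finrank K L ≤ Fintype.card ι := by
  classical
  have : FiniteDimensional K L := Module.Finite.of_injective X hX
  obtain ⟨s, hs⟩ := exists_bijective_funLeft_comp hX
  have hrank : Module.finrank K L = Fintype.card s := by
    simpa using (LinearEquiv.ofBijective _ hs).finrank_eq
  by_contra! hlt
  let Y : L →ₗ[K] (↥sᶜ → K) := LinearMap.funLeft K K (↑) ∘ₗ X
  have hker : LinearMap.ker Y ≠ ⊥ := LinearMap.ker_ne_bot_of_finrank_lt (by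
    rw [Module.finrank_fintype_fun_eq_card, Fintype.card_compl_set]
    omega)
  obtain ⟨v, hv, hv0⟩ := Submodule.exists_mem_ne_zero_of_ne_bot hker
  refine hv0 ((injective_iff_map_eq_zero _).1 hs.1 v ?_)
  refine eq_zero_of_forall_sum_add_pow_eq p (a := a) hm hmK fun η => ?_
  obtain ⟨ξ, rfl⟩ := hs.2 η
  have hsum : ∑ i : {i // i ∉ s}, X (ξ + v) i ^ (p ^ a * m) =
      ∑ i : {i // i ∉ s}, X ξ i ^ (p ^ a * m) :=
    Finset.sum_congr rfl fun i _ => by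
      have hvi : X v i = 0 := congrFun (LinearMap.mem_ker.1 hv) i
      rw [map_add, Pi.add_apply, hvi, add_zero]
  have heq := (h (ξ + v)).trans (h ξ).symm
  rw [← Fintype.sum_subtype_add_sum_subtype (fun i => i ∈ s), hsum,
    ← Fintype.sum_subtype_add_sum_subtype (fun i => i ∈ s)] at heq
  simpa [LinearMap.funLeft_apply] using add_right_cancel heq

theorem sum_range_two_mul_eq_zero {M : Type*} [AddCommMonoid M] {f : ℕ → M} {k : ℕ}
    (h : ∀ i < k, f (2 * i) + f (2 * i + 1) = 0) : ∑ j ∈ Finset.range (2 * k), f j = 0 := by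
  induction k with
  | zero => simp
  | succ k ih =>
    rw [mul_add_one, Finset.sum_range_succ, Finset.sum_range_succ, ih fun i hi => h i (by omega),
      zero_add, h k (by omega)]

theorem exists_forall_mem_eval_unitTensor_eq_zero {d : ℕ} (hd : d ≠ 0) {ζ : K} (hζ : ζ ^ d = -1)
    (r : ℕ) : ∃ L : Submodule K (Module.Dual K (Fin r → K)),
      (∀ ξ ∈ L, eval ξ (unitTensor K d r) = 0) ∧
      Module.finrank K (Module.Dual K (Fin r → K) ⧸ L) ≤ (r + 1) / 2 := by
  let e : ℕ → Fin r → K := fun j => if h : j < r then Pi.single ⟨j, h⟩ 1 else 0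
  let Φ : Module.Dual K (Fin r → K) →ₗ[K] (Fin ((r + 1) / 2) → K) :=
    LinearMap.pi fun i => Module.Dual.eval K _ (e (2 * i + 1) - ζ • e (2 * i))
  refine ⟨LinearMap.ker Φ, fun ξ hξ => ?_, ?_⟩
  · have hpairs : ∑ j ∈ Finset.range (2 * ((r + 1) / 2)), ξ (e j) ^ d = 0 := by
      refine sum_range_two_mul_eq_zero fun i hi => ?_
      have hΦ : ξ (e (2 * i + 1)) = ζ * ξ (e (2 * i)) := by
        simpa [Φ, sub_eq_zero] using congrFun (LinearMap.mem_ker.1 hξ) ⟨i, hi⟩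
      rw [hΦ, mul_pow, hζ]
      ring
    rw [eval_unitTensor, ← hpairs,
      ← Finset.sum_subset (Finset.range_mono (by omega : r ≤ 2 * ((r + 1) / 2))), Finset.sum_range]
    · simp [e]
    · intro j _ hj
      simp [e, Finset.mem_range.not.1 hj, hd]
  · rw [Φ.quotKerEquivRange.finrank_eq]
    simpa using Submodule.finrank_le (LinearMap.range Φ)

theorem sliceRank_unitTensor [Infinite K] (p : ℕ) [ExpChar K p] {a m : ℕ} (hm : 2 ≤ m)
    (hmK : (m : K) ≠ 0) {ζ : K} (hζ : ζ ^ (p ^ a * m) = -1) (r : ℕ) :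
    sliceRank (unitTensor K (p ^ a * m) r) = (((r + 1) / 2 : ℕ) : ℕ∞) := by
  refine le_antisymm ?_ (le_iInf₂ fun L hL => Nat.cast_le.2 ?_)
  · have hd : p ^ a * m ≠ 0 := mul_ne_zero (expChar_pow_pos K p a).ne' (by omega)
    obtain ⟨L, hL, hrank⟩ := exists_forall_mem_eval_unitTensor_eq_zero hd hζ r
    exact iInf₂_le_of_le L hL (Nat.cast_le.2 hrank)
  · let X : Module.Dual K (Fin r → K) →ₗ[K] (Fin r → K) :=
      LinearMap.pi fun i => Module.Dual.eval K _ (Pi.single i 1)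
    have hX : Function.Injective X := fun ξ η hξη =>
      LinearMap.pi_ext' fun i => LinearMap.ext_ring (congrFun hξη i)
    have hXL : Function.Injective (X ∘ₗ L.subtype) := hX.comp L.injective_subtype
    have hL' := two_mul_finrank_le_of_forall_sum_pow_eq_zero p (a := a) hm hmK hXL fun ξ : L =>
      (eval_unitTensor _).symm.trans (hL ξ.1 ξ.2)
    have hquot := L.finrank_quotient_add_finrank
    rw [Subspace.dual_finrank_eq, Module.finrank_fin_fun] at hquot
    rw [Fintype.card_fin] at hL'
    omega

theorem nat_ceil_div_two (r : ℕ) : ⌈(r : ℚ) / 2⌉₊ = (r + 1) / 2 := by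
  rw [← Int.natCast_inj, Int.natCast_ceil_eq_ceil (by positivity)]
  have h := Rat.ceil_natCast_div_natCast r 2
  push_cast at h
  omega

end SliceRank

section GeneralLinear

variable {K : Type u} [Field K] {n : Type*} [DecidableEq n]

variable (K n) in
/-- The restriction to `GL(K^n)` of polynomials in the entries of an `n × n` matrix: the variable
`(i, j)` becomes the `i`-th coordinate of the image of the `j`-th basis vector. -/
noncomputable def restrictGL :
    MvPolynomial (n × n) K →ₐ[K] (((n → K) ≃ₗ[K] (n → K)) → K) :=
  MvPolynomial.aeval fun ij g => g (Pi.single ij.2 1) ij.1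

theorem restrictGL_apply (P : MvPolynomial (n × n) K) (g : (n → K) ≃ₗ[K] (n → K)) :
    restrictGL K n P g = MvPolynomial.eval (fun ij => g (Pi.single ij.2 1) ij.1) P := by
  rw [restrictGL, ← MvPolynomial.coe_aeval_eq_eval]
  exact MvPolynomial.comp_aeval_apply _ (Pi.evalAlgHom K (fun _ => K) g) P

variable [Finite n]

theorem restrictGL_injective [Infinite K] : Function.Injective (restrictGL K n) := by
  cases nonempty_fintype n
  refine (injective_iff_map_eq_zero _).2 fun P hP => ?_
  refine (mul_eq_zero.1 (MvPolynomial.funext fun x => ?_ :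
    P * (Matrix.mvPolynomialX n n K).det = 0)).resolve_right
      (Matrix.det_mvPolynomialX_ne_zero n K)
  let M : Matrix n n K := Matrix.of fun i j => x (i, j)
  have hM : MvPolynomial.eval x (Matrix.mvPolynomialX n n K).det = M.det := by
    rw [RingHom.map_det]
    congr 1
    ext i j
    simp [M]
  rw [map_mul, map_zero, hM, mul_eq_zero, or_iff_not_imp_right]
  intro hdet
  have hPM := congrFun hP (LinearMap.equivOfDetNeZero (Matrix.toLin' M)
    (by rwa [LinearMap.det_toLin']))
  simpa [restrictGL_apply, LinearMap.equivOfDetNeZero, M] using hPM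

theorem apply_mem_range_restrictGL (v : n → K) (i : n) :
    (fun g : (n → K) ≃ₗ[K] (n → K) => g v i) ∈ (restrictGL K n).range := by
  cases nonempty_fintype n
  refine ⟨∑ j, MvPolynomial.C (v j) * MvPolynomial.X (i, j), funext fun g => ?_⟩
  conv_rhs => rw [pi_eq_sum_univ' v]
  simp [restrictGL_apply, Finset.sum_apply]

theorem dual_map_mem_range_restrictGL {d : ℕ} (ℓ : Module.Dual K (SymPow K d (n → K)))
    (f : SymPow K d (n → K)) :
    (fun g : (n → K) ≃ₗ[K] (n → K) => ℓ (map d g.toLinearMap f)) ∈ (restrictGL K n).range := by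
  cases nonempty_fintype n
  suffices h : ⊤ ≤ (Subalgebra.toSubmodule (restrictGL K n).range).comap
      (LinearMap.pi fun g : (n → K) ≃ₗ[K] (n → K) => ℓ ∘ₗ map d g.toLinearMap) from
    h Submodule.mem_top
  rw [← SymmetricPower.span_tprod_eq_top K _ (n → K), Submodule.span_le]
  rintro _ ⟨w, rfl⟩
  have hexpand : (fun g : (n → K) ≃ₗ[K] (n → K) =>
      ℓ (map d g.toLinearMap (SymmetricPower.tprod K w))) =
      ∑ φ : ULift.{u} (Fin d) → n, ℓ (SymmetricPower.tprod K fun a => Pi.single (φ a) 1) •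
        ∏ a, fun g : (n → K) ≃ₗ[K] (n → K) => g (w a) (φ a) := by
    funext g
    have hg : map d g.toLinearMap (SymmetricPower.tprod K w) =
        SymmetricPower.tprod K fun a => ∑ j, g (w a) j • (Pi.single j 1 : n → K) := by
      simp_rw [← pi_eq_sum_univ']
      exact map_simple g.toLinearMap fun i => w ⟨i⟩
    simp only [hg, MultilinearMap.map_sum, MultilinearMap.map_smul_univ, map_sum, map_smul,
      Finset.sum_apply, Pi.smul_apply, Finset.prod_apply, smul_eq_mul, mul_comm]
  change (fun g : (n → K) ≃ₗ[K] (n → K) =>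
    ℓ (map d g.toLinearMap (SymmetricPower.tprod K w))) ∈ (restrictGL K n).range
  rw [hexpand]
  exact sum_mem fun φ _ => Subalgebra.smul_mem _
    (prod_mem fun a _ => apply_mem_range_restrictGL (w a) (φ a)) _

end GeneralLinear

section Orbit

variable {K : Type u} [Field K] {d : ℕ}

/-- The pullback of functions along the orbit map `g ↦ g · f`. -/
noncomputable def orbitPullback {V : Type v} [AddCommGroup V] [Module K V] (f : SymPow K d V) :
    (glOrbit f → K) →ₐ[K] ((V ≃ₗ[K] V) → K) :=
  AlgHom.pi fun g => Pi.evalAlgHom K (fun _ => K) ⟨map d g.toLinearMap f, g, rfl⟩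

theorem orbitPullback_injective {V : Type v} [AddCommGroup V] [Module K V] (f : SymPow K d V) :
    Function.Injective (orbitPullback f) := by
  refine Function.Surjective.injective_comp_right
    (f := fun g : V ≃ₗ[K] V => (⟨map d g.toLinearMap f, g, rfl⟩ : glOrbit f)) ?_
  rintro ⟨_, g, rfl⟩
  exact ⟨g, rfl⟩

theorem exists_injective_algHom_polyFunctions_glOrbit [Infinite K] {n : Type v} [Finite n]
    (f : SymPow K d (n → K)) :
    ∃ φ : polyFunctions (K := K) (glOrbit f) →ₐ[K] MvPolynomial (n × n) K,
      Function.Injective φ := by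
  classical
  have hle : polyFunctions (K := K) (glOrbit f) ≤ (restrictGL K n).range.comap (orbitPullback f) :=
    Algebra.adjoin_le (by
      rintro _ ⟨ℓ, rfl⟩
      exact dual_map_mem_range_restrictGL ℓ f)
  let e := AlgEquiv.ofInjective (restrictGL K n) restrictGL_injective
  let φ := ((orbitPullback f).comp (polyFunctions (glOrbit f)).val).codRestrict
    (restrictGL K n).range fun x => hle x.2
  refine ⟨e.symm.toAlgHom.comp φ, e.symm.injective.comp fun x y hxy => ?_⟩
  exact Subtype.ext (orbitPullback_injective f (congrArg Subtype.val hxy))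

end Orbit

section EvalAlg

variable {K : Type u} [Field K] {V : Type v} [AddCommGroup V] [Module K V]
  {A : Type w} [CommRing A] [Algebra K A] {d : ℕ}

/-- The value of a symmetric tensor at an `A`-valued point of `V*`. -/
noncomputable def evalAlg (φ : V →ₗ[K] A) : SymPow K d V →ₗ[K] A :=
  lift ((MultilinearMap.mkPiAlgebra K (ULift.{u} (Fin d)) A).compLinearMap fun _ => φ)
    fun e v => by simpa using Equiv.prod_comp e fun i => φ (v i)

theorem evalAlg_simple (φ : V →ₗ[K] A) (v : Fin d → V) :
    evalAlg φ (simple K v) = ∏ i, φ (v i) :=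
  (lift_simple _ _ v).trans (by
    simpa using Equiv.prod_comp (Equiv.ulift.{u} (α := Fin d)) fun i => φ (v i))

open Polynomial

/-- The line `ξ + tη` in `V*`, as a point of `V*` over `K[t]`. -/
noncomputable def dualLine (ξ η : Module.Dual K V) : V →ₗ[K] K[X] :=
  Algebra.linearMap K K[X] ∘ₗ ξ + LinearMap.mulLeft K X ∘ₗ Algebra.linearMap K K[X] ∘ₗ η

theorem dualLine_apply (ξ η : Module.Dual K V) (v : V) :
    dualLine ξ η v = C (ξ v) + X * C (η v) :=
  rfl

/-- The linear form on `S^d V` taking `f` to the coefficient of `t^q` in `f(ξ + tη)`. -/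
noncomputable def lineCoeff (q : ℕ) (ξ η : Module.Dual K V) : Module.Dual K (SymPow K d V) :=
  lcoeff K q ∘ₗ evalAlg (dualLine ξ η)

theorem lineCoeff_simple_const (p : ℕ) [ExpChar K p] (a m : ℕ) (ξ η : Module.Dual K V) (v : V) :
    lineCoeff (p ^ a) ξ η (simple K fun _ : Fin (p ^ a * m) => v) =
      m * (ξ v ^ (m - 1) * η v) ^ p ^ a := by
  rw [lineCoeff, LinearMap.comp_apply, evalAlg_simple, Finset.prod_const, Finset.card_univ,
    Fintype.card_fin, lcoeff_apply, dualLine_apply, coeff_C_add_X_mul_C_pow]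

end EvalAlg

section RowPairing

open MvPolynomial

variable {n R : Type*} [Fintype n] [CommRing R]

/-- The polynomial `∑ k, M i k ^ (m - 1) * M j k` in the entries of a matrix `M`, for a pair
`(i, j)` of row indices. -/
noncomputable def rowPairing (R : Type*) [CommRing R] (m : ℕ) (ij : n × n) :
    MvPolynomial (n × n) R :=
  ∑ k, X (ij.1, k) ^ (m - 1) * X (ij.2, k)

theorem eval_one_pderiv_rowPairing [DecidableEq n] {m : ℕ} (hm : 3 ≤ m) (ij s : n × n) :
    MvPolynomial.eval (fun s => (1 : Matrix n n R) s.1 s.2) (pderiv s (rowPairing R m ij)) =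
      if s = ij.swap then if ij.1 = ij.2 then (m : R) else 1 else 0 := by
  obtain ⟨i, j⟩ := ij
  have h1 : m - 1 ≠ 0 := by omega
  have h2 : m - 1 - 1 ≠ 0 := by omega
  simp only [rowPairing, map_sum, Derivation.leibniz, Derivation.leibniz_pow, map_add]
  -- The summands with `k ≠ i` vanish to order `m - 1 ≥ 2` at the identity matrix.
  rw [Finset.sum_eq_single i]
  · rcases eq_or_ne i j with rfl | hij
    · rcases eq_or_ne s (i, i) with rfl | hs
      · simp [Nat.cast_pred (show 0 < m by omega)]
      · simp [pderiv_X_of_ne hs.symm, hs]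
    · rcases eq_or_ne s (j, i) with rfl | hs
      · simp [hij]
      · simp [pderiv_X_of_ne hs.symm, Matrix.one_apply_ne' hij, hs]
  · intro k _ hk
    simp [pderiv_X, Matrix.one_apply_ne' hk, h1, h2]
  · simp

theorem algebraicIndependent_rowPairing {m : ℕ} (hm : 3 ≤ m) (hmR : IsUnit (m : R)) :
    AlgebraicIndependent R (rowPairing (n := n) R m) := by
  classical
  obtain ⟨u, hu⟩ := hmR.exists_right_inv
  refine algebraicIndependent_of_jacobian_mul_eq_one (fun s => (1 : Matrix n n R) s.1 s.2)
    (Matrix.of fun s ij => if s = ij.swap then if ij.1 = ij.2 then u else 1 else 0) ?_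
  ext ij kl
  simp only [eval_one_pderiv_rowPairing hm, Matrix.mul_apply, Matrix.of_apply, ite_mul, zero_mul,
    Finset.sum_ite_eq', Finset.mem_univ, if_true]
  rcases eq_or_ne ij kl with rfl | hne
  · by_cases h : ij.1 = ij.2 <;> simp [h, hu]
  · simp [hne]

end RowPairing
section PolyFunctions

variable {K : Type u} [Field K] {W : Type w} [AddCommGroup W] [Module K W]

instance finiteType_polyFunctions [FiniteDimensional K W] (S : Set W) :
    Algebra.FiniteType K (polyFunctions (K := K) S) := by
  let Λ : Module.Dual K W →ₗ[K] (S → K) := LinearMap.pi fun x => Module.Dual.eval K W x.1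
  obtain ⟨t, ht⟩ := Module.Finite.iff_fg.1 (Module.Finite.range Λ)
  have h : polyFunctions (K := K) S = Algebra.adjoin K (t : Set (S → K)) := by
    rw [← Algebra.adjoin_span, ht]
    rfl
  rw [h]
  exact Algebra.FiniteType.adjoin_of_finite t.finite_toSet

/-- The restriction of a linear form to a subset, as a polynomial function. -/
def linearFunction (S : Set W) (ℓ : Module.Dual K W) : polyFunctions (K := K) S :=
  ⟨fun x => ℓ x.1, Algebra.subset_adjoin ⟨ℓ, rfl⟩⟩

instance finiteDimensional_symPow {d : ℕ} [FiniteDimensional K W] :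
    FiniteDimensional K (SymPow K d W) :=
  Module.Finite.of_surjective (SymmetricPower.mk K (ULift.{u} (Fin d)) W)
    (LinearMap.range_eq_top.1 (SymmetricPower.range_mk K _ W))

end PolyFunctions

section UnitTensorOrbit

variable {K : Type u} [Field K] (p : ℕ) [ExpChar K p] {a m r : ℕ}

theorem orbitPullback_linearFunction_lineCoeff (ij : Fin r × Fin r) :
    orbitPullback (unitTensor K (p ^ a * m) r)
        (linearFunction _ (lineCoeff (p ^ a) (LinearMap.proj ij.1) (LinearMap.proj ij.2))).1 =
      restrictGL K (Fin r) (MvPolynomial.C (m : K) * rowPairing K m ij ^ p ^ a) := by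
  funext g
  change lineCoeff (p ^ a) (LinearMap.proj ij.1) (LinearMap.proj ij.2)
    (map (p ^ a * m) g.toLinearMap (unitTensor K (p ^ a * m) r)) = _
  simp only [unitTensor, map_sum, map_simple, lineCoeff_simple_const, restrictGL_apply, rowPairing,
    map_mul, map_pow, MvPolynomial.eval_C, MvPolynomial.eval_X, sum_pow_char_pow, ← Finset.mul_sum]
  rfl

theorem algebraicIndependent_lineCoeff [Infinite K] (hm : 3 ≤ m) (hmK : (m : K) ≠ 0) :
    AlgebraicIndependent K fun ij : Fin r × Fin r =>
      linearFunction (glOrbit (unitTensor K (p ^ a * m) r))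
        (lineCoeff (p ^ a) (LinearMap.proj ij.1) (LinearMap.proj ij.2)) := by
  have hq : p ^ a ≠ 0 := (expChar_pow_pos K p a).ne'
  have htr : Transcendental K (Polynomial.C (m : K) * Polynomial.X ^ p ^ a) :=
    Polynomial.transcendental _ (by rwa [Polynomial.natDegree_C_mul_X_pow _ _ hmK])
      (by simpa only [Polynomial.leadingCoeff_C_mul_X_pow, mem_nonZeroDivisors_iff_ne_zero])
  have h := ((algebraicIndependent_rowPairing hm hmK.isUnit).polynomial_aeval_of_transcendental
    fun _ : Fin r × Fin r => htr).map' (f := restrictGL K (Fin r)) restrictGL_injective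
  refine AlgebraicIndependent.of_comp ((orbitPullback _).comp (polyFunctions _).val) ?_
  convert h using 1
  funext ij
  refine (orbitPullback_linearFunction_lineCoeff p ij).trans ?_
  simp

theorem varietyDim_glOrbit_unitTensor [Infinite K] (hm : 3 ≤ m) (hmK : (m : K) ≠ 0) (r : ℕ) :
    varietyDim K (glOrbit (unitTensor K (p ^ a * m) r)) = ((r ^ 2 : ℕ) : WithBot ℕ∞) := by
  let A := polyFunctions (K := K) (glOrbit (unitTensor K (p ^ a * m) r))
  obtain ⟨φ, hφ⟩ := exists_injective_algHom_polyFunctions_glOrbit (unitTensor K (p ^ a * m) r)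
  have : IsDomain A := hφ.isDomain φ.toRingHom
  have htr : Algebra.trdeg K A = (r ^ 2 : ℕ) := by
    refine le_antisymm ((trdeg_le_of_injective φ hφ).trans ?_) ?_
    · simp [MvPolynomial.trdeg_of_isDomain, sq]
    · simpa [sq] using
        (algebraicIndependent_lineCoeff (r := r) (a := a) p hm hmK).lift_cardinalMk_le_trdeg
  rw [varietyDim, ringKrullDim_eq_toNat_trdeg K A, htr, Cardinal.toNat_natCast]

end UnitTensorOrbit

theorem exists_eq_expChar_pow_mul (K : Type*) [Field K] (p : ℕ) [hp : ExpChar K p] {d : ℕ}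
    (hd : ∀ k : ℕ, d ≠ p ^ k * 0 ∧ d ≠ p ^ k * 1 ∧ d ≠ p ^ k * 2) :
    ∃ a m : ℕ, d = p ^ a * m ∧ 3 ≤ m ∧ (m : K) ≠ 0 := by
  obtain ⟨a, m, rfl, hm⟩ : ∃ a m : ℕ, d = p ^ a * m ∧ (m : K) ≠ 0 := by
    have h0 : d ≠ 0 := by simpa using (hd 0).1
    cases hp with
    | zero => exact ⟨0, d, by simp, by exact_mod_cast h0⟩
    | prime hprime =>
      obtain ⟨a, m, hm, rfl⟩ := Nat.exists_eq_pow_mul_and_not_dvd h0 p hprime.ne_one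
      exact ⟨a, m, rfl, by rwa [Ne, CharP.cast_eq_zero_iff K p]⟩
  refine ⟨a, m, rfl, ?_, hm⟩
  obtain ⟨h0, h1, h2⟩ := hd a
  by_contra! hlt
  interval_cases m <;> contradiction

end SymSubrank

theorem proposition2p1_general (K : Type*) [Field K] [Infinite K] (p : ℕ) [ExpChar K p] (d : ℕ)
    (hd : ∀ k : ℕ, d ≠ p ^ k * 0 ∧ d ≠ p ^ k * 1 ∧ d ≠ p ^ k * 2) (hζ : ∃ ζ : K, ζ ^ d = -1)
    (r : ℕ) :
    (∀ U : Submodule K (Fin r → K), U ≠ ⊤ →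
      SymSubrank.unitTensor K d r ∉ SymSubrank.symPowOf d U) ∧
    SymSubrank.sliceRank (SymSubrank.unitTensor K d r) = ((⌈(r : ℚ) / 2⌉₊ : ℕ) : ℕ∞) ∧
    SymSubrank.varietyDim K (SymSubrank.glOrbit (SymSubrank.unitTensor K d r)) =
      ((r ^ 2 : ℕ) : WithBot ℕ∞) := by
  obtain ⟨ζ, hζ⟩ := hζ
  obtain ⟨a, m, rfl, hm, hmK⟩ := SymSubrank.exists_eq_expChar_pow_mul K p hd
  refine ⟨fun U hU => SymSubrank.unitTensor_notMem_symPowOf p (by omega) hmK hU, ?_,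
    SymSubrank.varietyDim_glOrbit_unitTensor p hm hmK r⟩
  rw [SymSubrank.nat_ceil_div_two, SymSubrank.sliceRank_unitTensor p (by omega) hmK hζ]

/-- Here `p` is the characteristic exponent of `K`. -/
theorem proposition2p1 (K : Type*) [Field K] [IsAlgClosed K] (p : ℕ) [ExpChar K p] (d : ℕ)
    (hd : ∀ k : ℕ, d ≠ p ^ k * 0 ∧ d ≠ p ^ k * 1 ∧ d ≠ p ^ k * 2) (r : ℕ) :
    (∀ U : Submodule K (Fin r → K), U ≠ ⊤ →
      SymSubrank.unitTensor K d r ∉ SymSubrank.symPowOf d U) ∧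
    SymSubrank.sliceRank (SymSubrank.unitTensor K d r) = ((⌈(r : ℚ) / 2⌉₊ : ℕ) : ℕ∞) ∧
    SymSubrank.varietyDim K (SymSubrank.glOrbit (SymSubrank.unitTensor K d r)) =
      ((r ^ 2 : ℕ) : WithBot ℕ∞) :=
  proposition2p1_general K p d hd
    (IsAlgClosed.exists_pow_nat_eq (-1) (Nat.pos_of_ne_zero (by simpa using (hd 0).1))) r
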